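/- Let $I=(i_1,\dots,i_k)$ be positive integers with $i_1+\dots+i_k=n$, let $\lambda_1<\dots<\lambda_k$ be real numbers, and let $\Lambda$ be the diagonal $n\times n$ matrix whose diagonal is $\lambda_1$ ($i_1$ times), then $\lambda_2$ ($i_2$ times), and so on. On $SO(n,\mathbb R)$ consider the vector field of the full symmetric (FS) Toda lattice $$M(\Psi)=\big((\Psi\Lambda\Psi^{-1})_+-(\Psi\Lambda\Psi^{-1})_-\big)\Psi,$$ where $L_+$ and $L_-$ are the strictly upper and strictly lower triangular parts of $L$, and the function $F(\Psi)=\operatorname{Tr}(\Psi\Lambda\Psi^{T}N)$ with $N=\operatorname{diag}(0,1,\dots,n-1)$. Equip $SO(n,\mathbb R)$ with the right-invariant Riemannian metric given on antisymmetric matrices by $\langle A,C\rangle=-\operatorname{Tr}(A\,J^{-1}(C))=\sum_{a,b}|a-b|\,A_{ab}C_{ab}$, where $(J^{-1}C)_{ab}=|a-b|\,C_{ab}$. Let $\mathrm{Fl}_I(\mathbb R)$ be the manifold of partial flags $0=V_0\subset V_1\subset\dots\subset V_k=\mathbb R^n$ with $\dim V_l=i_1+\dots+i_l$, and let $$\pi: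 SO(n,\mathbb R)\to \mathrm{Fl}_I(\mathbb R)=SO(n,\mathbb R)\big/\big(SO(n,\mathbb R)\cap(O(i_1)\times\dots\times O(i_k))\big)$$ send $\Psi$ to the flag whose space $V_l$ is spanned by the first $i_1+\dots+i_l$ columns of $\Psi$. Let $S_n^I$ be the set of multiset permutations, i.e. of surjective maps $\tau:\{1,\dots,n\}\to\{1,\dots,k\}$ with $|\tau^{-1}(j)|=i_j$ for all $j$. Then there are a unique vector field $\xi_I$ and a unique function $\widetilde F$ on $\mathrm{Fl}_I(\mathbb R)$ with $\xi_I(\pi(\Psi))=d\pi_\Psi(M(\Psi))$ and $\widetilde F(\pi(\Psi))=F(\Psi)$ for all $\Psi\in SO(n,\mathbb R)$. The function $-\widetilde F$ is a Morse function, and $\xi_I$ is its gradient for the Riemannian metric induced on $\mathrm{Fl}_I(\mathbb R)$. The singular points (zeros) of $\xi_I$ are indexed by the multiset permutations: the map sending $\tau$ to the coordinate flag $$V_l=\operatorname{span}\{e_m : \tau(m)\le l\},\qquad l=0,\dots,k,$$ is a bijection from $S_n^I$ onto the set of singular points of $\xi_I$. Moreover, if $w\in S_n$ and $\Psi\in SO(n,\mathbb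 R)$ is a signed permutation matrix with $|\Psi_{j,w(j)}|=1$ for all $j$, then $\pi(\Psi)$ is the singular point indexed by $\tau_1\circ w$, where $\tau_1$ is the weakly increasing element of $S_n^I$. -/

import Mathlib

open Matrix

noncomputable section

namespace FSToda

/-- The special orthogonal group `SO(n, ℝ)`. -/
abbrev SO (n : ℕ) := Matrix.specialOrthogonalGroup (Fin n) ℝ

/-- The Lie algebra `𝔰𝔬(n)` of antisymmetric real matrices. -/
abbrev soAlg (n : ℕ) := LieAlgebra.Orthogonal.so (Fin n) ℝ

/-! ## Multiset permutations -/

/-- `S_n^I`: the surjective maps `τ` from `n` letters to `k` letters that take the `j`-th value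
exactly `I j` times. -/
abbrev MultisetPerm (n : ℕ) {k : ℕ} (I : Fin k → ℕ) : Type :=
  {τ : Fin n → Fin k //
    Function.Surjective τ ∧ ∀ j, (Finset.univ.filter fun m => τ m = j).card = I j}

/-- The block map `τ₁`: it sends the first `I 0` indices to `0`, the next `I 1` indices to `1`,
and so on (see `blockIndex_spec`). -/
def blockIndex {n k : ℕ} (I : Fin k → ℕ) (hn : ∑ j, I j = n) (m : Fin n) : Fin k :=
  (finSigmaFinEquiv.symm (Fin.cast hn.symm m)).1

theorem blockIndex_spec {n k : ℕ} (I : Fin k → ℕ) (hn : ∑ j, I j = n) (m : Fin n) :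
    (∑ j with j < blockIndex I hn m, I j) ≤ (m : ℕ) ∧
      (m : ℕ) < (∑ j with j < blockIndex I hn m, I j) + I (blockIndex I hn m) := by
  have h := finSigmaFinEquiv_apply (finSigmaFinEquiv.symm (Fin.cast hn.symm m))
  rw [Equiv.apply_symm_apply, Fin.val_cast] at h
  have h2 : ∀ a : Fin k, (∑ i : Fin a.1, I (Fin.castLE a.2.le i)) = ∑ j with j < a, I j := by
    intro a
    refine Finset.sum_bij (fun i _ => Fin.castLE a.2.le i) ?_ ?_ ?_ ?_
    · intro i _
      simp only [Finset.mem_filter, Finset.mem_univ, true_and]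
      exact i.2
    · intro i _ j _ hij
      simpa [Fin.ext_iff] using hij
    · intro b hb
      simp only [Finset.mem_filter, Finset.mem_univ, true_and, Fin.lt_def] at hb
      exact ⟨⟨b, hb⟩, Finset.mem_univ _, by simp⟩
    · intro i _
      rfl
  rw [h2] at h
  have h3 := (finSigmaFinEquiv.symm (Fin.cast hn.symm m)).2.2
  unfold blockIndex
  omega

theorem card_blockIndex {n k : ℕ} (I : Fin k → ℕ) (hn : ∑ j, I j = n) (j : Fin k) :
    (Finset.univ.filter fun m => blockIndex I hn m = j).card = I j := by
  subst hn
  rw [← Fintype.card_fin (I j), ← Fintype.card_subtype]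
  refine Fintype.card_congr ?_
  refine (Equiv.subtypeEquiv (q := fun s : (i : Fin k) × Fin (I i) => s.1 = j)
    finSigmaFinEquiv.symm ?_).trans (Equiv.sigmaSubtype j)
  intro a
  rfl

/-- `τ₁` as an element of `S_n^I`. -/
def blockPerm {n k : ℕ} (I : Fin k → ℕ) (hI : ∀ j, 0 < I j) (hn : ∑ j, I j = n) :
    MultisetPerm n I :=
  ⟨blockIndex I hn, by
    intro j
    have h := card_blockIndex I hn j
    have h2 : (Finset.univ.filter fun m => blockIndex I hn m = j).Nonempty := by
      rw [← Finset.card_pos, h]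
      exact hI j
    obtain ⟨m, hm⟩ := h2
    exact ⟨m, by simpa using hm⟩, card_blockIndex I hn⟩

/-- The map `S_n → S_n^I`, `w ↦ τ ∘ w`. -/
def MultisetPerm.comp {n k : ℕ} {I : Fin k → ℕ} (τ : MultisetPerm n I)
    (w : Equiv.Perm (Fin n)) : MultisetPerm n I :=
  ⟨τ.1 ∘ w, τ.2.1.comp w.surjective, by
    intro j
    rw [← τ.2.2 j]
    refine Finset.card_bij (fun m _ => w m) ?_ ?_ ?_
    · intro m hm
      simpa using hm
    · intro a _ b _ hab
      exact w.injective hab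
    · intro b hb
      exact ⟨w.symm b, by simpa using hb, by simp⟩⟩

/-! ## Partial flags -/

/-- A point of the partial flag space `Fl_I(ℝ)`: a chain `0 = V_0 ⊆ V_1 ⊆ ⋯ ⊆ V_k = ℝⁿ` of
subspaces with `dim V_l = i_1 + ⋯ + i_l`. -/
@[ext]
structure PartialFlag (n : ℕ) {k : ℕ} (I : Fin k → ℕ) where
  space : Fin (k + 1) → Submodule ℝ (EuclideanSpace ℝ (Fin n))
  space_zero : space 0 = ⊥
  space_last : space (Fin.last k) = ⊤
  mono : Monotone space
  finrank_space : ∀ l, Module.finrank ℝ (space l) = ∑ j with j.castSucc < l, I j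

/-- The coordinate flag of a multiset permutation `τ`: the `l`-th space is spanned by the standard
basis vectors `e_m` for which `τ m` is one of the first `l` letters. -/
def coordFlag {n k : ℕ} {I : Fin k → ℕ} (τ : MultisetPerm n I) : PartialFlag n I where
  space l := Submodule.span ℝ
    ((fun m => EuclideanSpace.single m (1 : ℝ)) '' {m : Fin n | (τ.1 m).castSucc < l})
  space_zero := by simp
  space_last := by
    have h : {m : Fin n | (τ.1 m).castSucc < Fin.last k} = Set.univ := by
      ext m
      simp [Fin.castSucc_lt_last]
    rw [h, Set.image_univ]
    have h2 := (EuclideanSpace.basisFun (Fin n) ℝ).toBasis.span_eq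
    rw [← h2]
    congr 2
    ext1 m
    simp
  mono := by
    intro a b hab
    refine Submodule.span_mono (Set.image_mono ?_)
    intro m hm
    exact lt_of_lt_of_le hm hab
  finrank_space := by
    intro l
    have hli : LinearIndependent ℝ
        (fun m : Fin n => (EuclideanSpace.single m (1 : ℝ) : EuclideanSpace ℝ (Fin n))) := by
      have h2 := (EuclideanSpace.basisFun (Fin n) ℝ).toBasis.linearIndependent
      have e : (fun m : Fin n => (EuclideanSpace.single m (1 : ℝ) : EuclideanSpace ℝ (Fin n))) =
          (EuclideanSpace.basisFun (Fin n) ℝ).toBasis := by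
        ext1 m
        simp
      rw [e]
      exact h2
    have hli2 := hli.comp
      (Subtype.val : {m : Fin n // (τ.1 m).castSucc < l} → Fin n) Subtype.val_injective
    have h3 := finrank_span_eq_card hli2
    have h4 : Set.range ((fun m : Fin n =>
        (EuclideanSpace.single m (1 : ℝ) : EuclideanSpace ℝ (Fin n))) ∘
        (Subtype.val : {m : Fin n // (τ.1 m).castSucc < l} → Fin n)) =
        (fun m => EuclideanSpace.single m (1 : ℝ)) '' {m : Fin n | (τ.1 m).castSucc < l} := by
      rw [Set.range_comp]
      congr 1
      exact Subtype.range_val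
    rw [h4] at h3
    rw [h3, Fintype.card_subtype,
      Finset.card_eq_sum_card_fiberwise (f := τ.1)
        (t := Finset.univ.filter fun j : Fin k => j.castSucc < l) (by intro m; simp)]
    refine Finset.sum_congr rfl ?_
    intro j hj
    rw [← τ.2.2 j, Finset.filter_filter]
    congr 1
    ext m
    simp only [Finset.mem_filter, Finset.mem_univ, true_and] at hj ⊢
    constructor
    · exact fun h => h.2
    · intro h
      exact ⟨h ▸ hj, h⟩

theorem SO.transpose_mul {n : ℕ} (Φ : SO n) : (Φ : Matrix (Fin n) (Fin n) ℝ)ᵀ * Φ.1 = 1 :=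
  (Matrix.mem_orthogonalGroup_iff' (Fin n) ℝ).1 Φ.2.1

theorem SO.mul_transpose {n : ℕ} (Φ : SO n) : (Φ : Matrix (Fin n) (Fin n) ℝ) * Φ.1ᵀ = 1 :=
  (Matrix.mem_orthogonalGroup_iff (Fin n) ℝ).1 Φ.2.1

/-- The action of `SO(n, ℝ)` on `Fl_I(ℝ)`, `(Φ • V)_l = Φ V_l`. -/
def moveFlag {n k : ℕ} {I : Fin k → ℕ} (Φ : SO n) (V : PartialFlag n I) : PartialFlag n I where
  space l := (V.space l).map (Matrix.toEuclideanLin Φ.1)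
  space_zero := by rw [V.space_zero, Submodule.map_bot]
  space_last := by
    rw [V.space_last, Submodule.map_top, LinearMap.range_eq_top]
    intro v
    refine ⟨Matrix.toEuclideanLin Φ.1ᵀ v, ?_⟩
    simp [Matrix.toLpLin_apply, Matrix.mulVec_mulVec, SO.mul_transpose]
  mono := fun _ _ h => Submodule.map_mono (V.mono h)
  finrank_space := by
    intro l
    rw [← V.finrank_space l]
    have hinj : Function.Injective (Matrix.toEuclideanLin Φ.1) := by
      intro v w hvw
      have h := congrArg (Matrix.toEuclideanLin Φ.1ᵀ) hvw
      simpa [Matrix.toLpLin_apply, Matrix.mulVec_mulVec, SO.transpose_mul] using h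
    exact (Submodule.equivMapOfInjective _ hinj (V.space l)).finrank_eq.symm

/-- The projection `π : SO(n, ℝ) → Fl_I(ℝ) = SO(n, ℝ) / (SO(n, ℝ) ∩ (O(i_1) × ⋯ × O(i_k)))`:
the `l`-th space of `π Ψ` is spanned by the first `i_1 + ⋯ + i_l` columns of `Ψ`. -/
def flagProj {n k : ℕ} (I : Fin k → ℕ) (hI : ∀ j, 0 < I j) (hn : ∑ j, I j = n) (Ψ : SO n) :
    PartialFlag n I :=
  moveFlag Ψ (coordFlag (blockPerm I hI hn))

/-! ## The smooth structure of `Fl_I(ℝ)` and vector fields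

`Fl_I(ℝ)` carries the smooth structure of a closed submanifold of a vector space: a flag is given
by the tuple of the orthogonal projections onto its members. -/

/-- The vector space of tuples of operators on `ℝⁿ`, in which `Fl_I(ℝ)` is embedded. -/
abbrev Ambient (n k : ℕ) :=
  Fin (k + 1) → (EuclideanSpace ℝ (Fin n) →L[ℝ] EuclideanSpace ℝ (Fin n))

/-- The embedding of `Fl_I(ℝ)`. -/
def PartialFlag.embed {n k : ℕ} {I : Fin k → ℕ} (V : PartialFlag n I) : Ambient n k :=
  fun l => (V.space l).starProjection

/-- `γ` is a curve in `SO(n, ℝ)` with `γ(0) = Ψ` and velocity `X` at `0`. -/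
def IsCurve {n : ℕ} (γ : ℝ → SO n) (Ψ : SO n) (X : Matrix (Fin n) (Fin n) ℝ) : Prop :=
  γ 0 = Ψ ∧ ∀ i j, HasDerivAt (fun t => (γ t).1 i j) (X i j) 0

/-- For `X` tangent to `SO(n, ℝ)` at `Ψ`: `dπ_Ψ(X) = v`. -/
def IsPushforward {n k : ℕ} (I : Fin k → ℕ) (hI : ∀ j, 0 < I j) (hn : ∑ j, I j = n)
    (Ψ : SO n) (X : Matrix (Fin n) (Fin n) ℝ) (v : Ambient n k) : Prop :=
  ∀ γ : ℝ → SO n, IsCurve γ Ψ X → HasDerivAt (fun t => (flagProj I hI hn (γ t)).embed) v 0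

/-! ## The Toda field -/

/-- `L₊ - L₋`, where `L₊` and `L₋` are the strictly upper and strictly lower triangular parts. -/
def upperMinusLower {n : ℕ} (L : Matrix (Fin n) (Fin n) ℝ) : Matrix (Fin n) (Fin n) ℝ :=
  Matrix.of fun i j => if i < j then L i j else if j < i then -L i j else 0

/-- The diagonal matrix `Λ` with the eigenvalues `lam 0 < lam 1 < ⋯` in this order, the `j`-th of
them repeated `I j` times. -/
def eigMatrix {n k : ℕ} (I : Fin k → ℕ) (hn : ∑ j, I j = n) (lam : Fin k → ℝ) :
    Matrix (Fin n) (Fin n) ℝ :=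
  Matrix.diagonal fun m => lam (blockIndex I hn m)

/-- The Toda field `M(Ψ) = ((Ψ Λ Ψ⁻¹)₊ - (Ψ Λ Ψ⁻¹)₋) Ψ` on `SO(n, ℝ)`; here `Ψ⁻¹ = Ψᵀ`. -/
def todaField {n : ℕ} (Λ : Matrix (Fin n) (Fin n) ℝ) (Ψ : SO n) : Matrix (Fin n) (Fin n) ℝ :=
  upperMinusLower (Ψ.1 * Λ * Ψ.1ᵀ) * Ψ.1

/-- The field `ξ` on `Fl_I(ℝ)` is induced by the Toda field: `ξ(π Ψ) = dπ_Ψ(M(Ψ))` for every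
`Ψ` in `SO(n, ℝ)`. -/
def IsInducedField {n k : ℕ} (I : Fin k → ℕ) (hI : ∀ j, 0 < I j) (hn : ∑ j, I j = n)
    (lam : Fin k → ℝ) (ξ : PartialFlag n I → Ambient n k) : Prop :=
  ∀ Ψ : SO n, IsPushforward I hI hn Ψ (todaField (eigMatrix I hn lam) Ψ) (ξ (flagProj I hI hn Ψ))

/-- The function `F(Ψ) = Tr(Ψ Λ Ψᵀ N)`, `N = diag(0, 1, …, n - 1)`, on `SO(n, ℝ)`. -/
def todaFun {n : ℕ} (Λ : Matrix (Fin n) (Fin n) ℝ) (Ψ : SO n) : ℝ :=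
  Matrix.trace (Ψ.1 * Λ * Ψ.1ᵀ * Matrix.diagonal fun i : Fin n => ((i : ℕ) : ℝ))

/-- The function `f` on `Fl_I(ℝ)` is induced by `F`. -/
def IsInducedFun {n k : ℕ} (I : Fin k → ℕ) (hI : ∀ j, 0 < I j) (hn : ∑ j, I j = n)
    (lam : Fin k → ℝ) (f : PartialFlag n I → ℝ) : Prop :=
  ∀ Ψ : SO n, f (flagProj I hI hn Ψ) = todaFun (eigMatrix I hn lam) Ψ

/-! ## The Riemannian metric and gradient fields -/

/-- The scalar product `⟨A, C⟩_J = -Tr(A J⁻¹(C))` on `𝔰𝔬(n)`, where `J⁻¹` multiplies the `(i, j)`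
entry by `|i - j|`. It is extended to all of `SO(n, ℝ)` by right translations:
`g_Ψ(A Ψ, C Ψ) = ⟨A, C⟩_J`. -/
def todaInner {n : ℕ} (A C : Matrix (Fin n) (Fin n) ℝ) : ℝ :=
  -Matrix.trace (A * Matrix.of fun i j : Fin n => |((i : ℕ) : ℝ) - ((j : ℕ) : ℝ)| * C i j)

/-- The tangent vector `A Ψ` at `Ψ` is orthogonal to the fibre of `π` through `Ψ`, whose tangent
vectors are `Ψ X` with `X` antisymmetric and block diagonal. -/
def IsHorizontal {n k : ℕ} (I : Fin k → ℕ) (hn : ∑ j, I j = n) (Ψ : SO n) (A : soAlg n) : Prop :=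
  ∀ X : soAlg n, (∀ i j, blockIndex I hn i ≠ blockIndex I hn j → X.1 i j = 0) →
    todaInner A.1 (Ψ.1 * X.1 * Ψ.1ᵀ) = 0

/-- `ξ` is the gradient of `f` for the metric on `Fl_I(ℝ)` induced by the metric on `SO(n, ℝ)`,
i.e. the one for which the scalar product of two tangent vectors is that of their horizontal lifts:
`ξ(π Ψ)` has a horizontal lift `A Ψ`, and the derivative of `f` in the direction `dπ_Ψ(C Ψ)` is
`⟨C, A⟩_J` for every horizontal vector `C Ψ`. -/
def IsGradientField {n k : ℕ} (I : Fin k → ℕ) (hI : ∀ j, 0 < I j) (hn : ∑ j, I j = n)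
    (f : PartialFlag n I → ℝ) (ξ : PartialFlag n I → Ambient n k) : Prop :=
  ∀ Ψ : SO n, ∃ A : soAlg n, IsHorizontal I hn Ψ A ∧
    IsPushforward I hI hn Ψ (A.1 * Ψ.1) (ξ (flagProj I hI hn Ψ)) ∧
    ∀ C : soAlg n, IsHorizontal I hn Ψ C →
      ∀ γ : ℝ → SO n, IsCurve γ Ψ (C.1 * Ψ.1) →
        HasDerivAt (fun t => f (flagProj I hI hn (γ t))) (todaInner C.1 A.1) 0

/-! ## Morse functions -/

theorem exp_orthogonal {n : ℕ} (A : soAlg n) (t : ℝ) :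
    NormedSpace.exp (t • A.1) ∈ Matrix.orthogonalGroup (Fin n) ℝ := by
  have hA : A.1ᵀ = -A.1 := (LieAlgebra.Orthogonal.mem_so (Fin n) ℝ A.1).1 A.2
  rw [Matrix.mem_orthogonalGroup_iff]
  rw [← Matrix.exp_transpose, Matrix.transpose_smul, hA, smul_neg,
    ← Matrix.exp_add_of_commute _ _ ((Commute.refl (t • A.1)).neg_right), add_neg_cancel,
    NormedSpace.exp_zero]

/-- The rotation `exp(t A)`. -/
def soExp {n : ℕ} (A : soAlg n) (t : ℝ) : SO n :=
  ⟨NormedSpace.exp (t • A.1), exp_orthogonal A t, by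
    have h1 := exp_orthogonal A (t / 2)
    have h2 : NormedSpace.exp (t • A.1) =
        NormedSpace.exp ((t / 2) • A.1) * NormedSpace.exp ((t / 2) • A.1) := by
      rw [← Matrix.exp_add_of_commute _ _ (Commute.refl _), ← add_smul, add_halves]
    have h3 := congrArg Matrix.det ((Matrix.mem_orthogonalGroup_iff' (Fin n) ℝ).1 h1)
    rw [Matrix.det_mul, Matrix.det_one] at h3
    change Matrix.det (NormedSpace.exp (t • A.1)) = 1
    rw [h2, Matrix.det_mul]
    rwa [Matrix.det_transpose] at h3⟩

/-- The derivative of `f` along the vector field `Â(V) = d/dt exp(t A) V` (at `t = 0`) on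
`Fl_I(ℝ)`. At every point these fields span the tangent space. -/
def flagDeriv {n k : ℕ} {I : Fin k → ℕ} (A : soAlg n) (f : PartialFlag n I → ℝ)
    (V : PartialFlag n I) : ℝ :=
  deriv (fun t => f (moveFlag (soExp A t) V)) 0

/-- `f` is a Morse function on `Fl_I(ℝ)`: it is smooth, and at each of its critical points the
Hessian `H(Â, Ĉ) = Â(Ĉ(f))` is a nondegenerate bilinear form on the tangent space. -/
def IsMorse {n k : ℕ} {I : Fin k → ℕ} (f : PartialFlag n I → ℝ) : Prop :=
  (∃ g : Ambient n k → ℝ, ContDiff ℝ (⊤ : ℕ∞) g ∧ ∀ V : PartialFlag n I, f V = g V.embed) ∧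
  ∀ V : PartialFlag n I, (∀ A : soAlg n, flagDeriv A f V = 0) →
    ∀ A : soAlg n, (∀ C : soAlg n, flagDeriv A (flagDeriv C f) V = 0) →
      HasDerivAt (fun t => (moveFlag (soExp A t) V).embed) 0 0

end FSToda

end

noncomputable section

namespace FSToda

variable {n k : ℕ} {I : Fin k → ℕ}

/-! ## Projection matrices of a flag -/

/-! Replace a flag by the matrices `P_l` of the orthogonal projections onto its spaces. Then `SO(n)`
acts by conjugation, and the symmetric matrix `L = ΨΛΨᵀ = ∑ λ_j (P_{j+1} - P_j)` depends on the flag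
alone. So do `F = Tr(LN)` and, since the velocity `AΨ` moves `P_l` by the commutator `[A, P_l]`, the
pushforward of the Toda field, which is `[L₊ - L₋, P_l]`. Since every flag is some `π(Ψ)`
(`flagProj_surjective`), the induced field and function are unique.

The metric is designed so that `|i - j| (L₊ - L₋)_{ij} = (j - i) L_{ij}`. Hence `⟨C, L₊ - L₋⟩_J =
-Tr([C, L]N)` (`todaInner_upperMinusLower`), and the right side is the derivative of `-F` along
`CΨ`: this is the gradient property. Directions tangent to the fibre commute with `L`, so `L₊ - L₋`
is horizontal.

Positivity of the metric does the rest. If `S` is symmetric and `Tr([C, S]N) = 0` for all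
antisymmetric `C`, then `C = S₊ - S₋` has norm zero and `S` is diagonal. With `S = L`, critical
points have diagonal `L`; the same holds at zeros of the field, where `L₊ - L₋` commutes with `L`.
As the `λ_j` are distinct, a diagonal `L` forces a coordinate flag. With `S = [A, L]`, a vector `A`
in the kernel of the Hessian satisfies `[A, L] = 0`, hence `[A, P_l] = 0` for all `l`, so its
tangent vector is zero. -/

/-- The matrix of the orthogonal projection onto the `l`-th space of a flag. -/
def flagMat (V : PartialFlag n I) (l : Fin (k + 1)) : Matrix (Fin n) (Fin n) ℝ :=
  (Matrix.toEuclideanCLM (n := Fin n) (𝕜 := ℝ)).symm (V.embed l)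

theorem embed_eq (V : PartialFlag n I) (l : Fin (k + 1)) :
    V.embed l = Matrix.toEuclideanCLM (n := Fin n) (𝕜 := ℝ) (flagMat V l) :=
  (StarAlgEquiv.apply_symm_apply _ _).symm

theorem embed_injective : Function.Injective (PartialFlag.embed (n := n) (I := I)) := by
  intro V W h
  ext1
  funext l
  exact Submodule.starProjection_inj.1 (congrFun h l)

theorem flagMat_injective : Function.Injective (flagMat (n := n) (I := I)) := by
  intro V W h
  refine embed_injective ?_
  funext l
  rw [embed_eq, embed_eq, h]

theorem inner_toEuclideanCLM_left (A : Matrix (Fin n) (Fin n) ℝ) (x y : EuclideanSpace ℝ (Fin n)) :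
    inner ℝ (Matrix.toEuclideanCLM (n := Fin n) (𝕜 := ℝ) A x) y =
      inner ℝ x (Matrix.toEuclideanCLM (n := Fin n) (𝕜 := ℝ) Aᵀ y) := by
  rw [real_inner_comm, Matrix.inner_toEuclideanCLM, Matrix.inner_toEuclideanCLM,
    Matrix.dotProduct_mulVec, Matrix.mulVec_transpose, dotProduct_comm]

/-- An orthogonal projection is characterised by its value lying in the subspace and its error being
orthogonal to it; `Φᵀ` is both adjoint and inverse to `Φ`, which transports both properties. -/
theorem flagMat_moveFlag (Φ : SO n) (V : PartialFlag n I) (l : Fin (k + 1)) :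
    flagMat (moveFlag Φ V) l = Φ.1 * flagMat V l * Φ.1ᵀ := by
  refine EquivLike.injective (Matrix.toEuclideanCLM (n := Fin n) (𝕜 := ℝ)) ?_
  rw [← embed_eq, map_mul, map_mul, ← embed_eq]
  ext1 x
  refine Submodule.eq_starProjection_of_mem_orthogonal ?_ ?_
  · exact Submodule.mem_map_of_mem ((V.space l).starProjection_apply_mem _)
  · rw [Submodule.mem_orthogonal]
    rintro _ ⟨y, hy, rfl⟩
    have h := (Submodule.mem_orthogonal _ _).1 (Submodule.sub_starProjection_mem_orthogonal
      (K := V.space l) (Matrix.toEuclideanCLM (n := Fin n) (𝕜 := ℝ) Φ.1ᵀ x)) y hy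
    change inner ℝ (Matrix.toEuclideanCLM (n := Fin n) (𝕜 := ℝ) Φ.1 y) _ = 0
    rw [inner_toEuclideanCLM_left, map_sub]
    simp only [mul_apply_eq_comp]
    rw [← mul_apply_eq_comp (Matrix.toEuclideanCLM (n := Fin n) (𝕜 := ℝ) Φ.1ᵀ)
      (Matrix.toEuclideanCLM (n := Fin n) (𝕜 := ℝ) Φ.1), ← map_mul, SO.transpose_mul, map_one]
    exact h

/-- The diagonal projection matrix of a word `τ` at level `l`. -/
def indMat (τ : Fin n → Fin k) (l : Fin (k + 1)) : Matrix (Fin n) (Fin n) ℝ :=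
  Matrix.diagonal fun m => if (τ m).castSucc < l then 1 else 0

theorem flagMat_coordFlag (τ : MultisetPerm n I) (l : Fin (k + 1)) :
    flagMat (coordFlag τ) l = indMat τ.1 l := by
  refine EquivLike.injective (Matrix.toEuclideanCLM (n := Fin n) (𝕜 := ℝ)) ?_
  rw [← embed_eq]
  ext1 x
  have hx : ∀ m, (Matrix.toEuclideanCLM (n := Fin n) (𝕜 := ℝ) (indMat τ.1 l) x) m =
      if (τ.1 m).castSucc < l then x m else 0 := by
    intro m
    rw [Matrix.ofLp_toEuclideanCLM, indMat, Matrix.mulVec_diagonal]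
    split_ifs <;> simp
  refine Submodule.eq_starProjection_of_mem_orthogonal ?_ ?_
  · rw [← (EuclideanSpace.basisFun (Fin n) ℝ).sum_repr
      (Matrix.toEuclideanCLM (n := Fin n) (𝕜 := ℝ) (indMat τ.1 l) x)]
    refine Submodule.sum_mem _ fun m _ => ?_
    rw [EuclideanSpace.basisFun_repr, EuclideanSpace.basisFun_apply, hx]
    split_ifs with h
    · exact Submodule.smul_mem _ _ (Submodule.subset_span ⟨m, h, rfl⟩)
    · rw [zero_smul]
      exact Submodule.zero_mem _
  · change _ ∈ (Submodule.span ℝ _)ᗮ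
    rw [Submodule.mem_orthogonal]
    intro u hu
    induction hu using Submodule.span_induction with
    | mem y hy =>
      obtain ⟨m, hm, rfl⟩ := hy
      have hm' : (τ.1 m).castSucc < l := hm
      rw [EuclideanSpace.inner_single_left, PiLp.sub_apply, hx, if_pos hm']
      simp
    | zero => simp
    | add y z _ _ hy hz => rw [inner_add_left, hy, hz, add_zero]
    | smul a y _ hy => rw [inner_smul_left, hy, mul_zero]

/-! ## The orbit map is surjective -/

/-- For `i < j` the layer `i` lies in `V_{i+1} ⊆ V_j`, to which the layer `j` is orthogonal by
construction. -/
theorem orthogonalFamily_layers (V : PartialFlag n I) :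
    OrthogonalFamily ℝ (fun j : Fin k => ↥((V.space j.castSucc)ᗮ ⊓ V.space j.succ))
      fun j => ((V.space j.castSucc)ᗮ ⊓ V.space j.succ).subtypeₗᵢ := by
  have key : ∀ i j : Fin k, i < j → ∀ v w : EuclideanSpace ℝ (Fin n),
      v ∈ (V.space i.castSucc)ᗮ ⊓ V.space i.succ → w ∈ (V.space j.castSucc)ᗮ ⊓ V.space j.succ →
        inner ℝ v w = 0 := by
    intro i j hij v w hv hw
    refine (Submodule.mem_orthogonal _ _).1 hw.1 v (V.mono ?_ hv.2)
    rw [Fin.le_def]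
    exact hij
  intro i j hij v w
  rcases lt_or_gt_of_ne hij with h | h
  · exact key i j h v w v.2 w.2
  · rw [real_inner_comm]
    exact key j i h w v w.2 v.2

theorem finrank_layer (V : PartialFlag n I) (j : Fin k) :
    Module.finrank ℝ ↥((V.space j.castSucc)ᗮ ⊓ V.space j.succ) = I j := by
  have h := Submodule.finrank_add_inf_finrank_orthogonal
    (V.mono (Fin.castSucc_lt_succ (i := j)).le)
  rw [V.finrank_space, V.finrank_space] at h
  have h2 : (Finset.univ.filter fun i : Fin k => i.castSucc < j.succ) =
      insert j (Finset.univ.filter fun i : Fin k => i.castSucc < j.castSucc) := by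
    ext i
    simp only [Finset.mem_filter, Finset.mem_univ, true_and, Finset.mem_insert, Fin.lt_def,
      Fin.ext_iff, Fin.val_castSucc, Fin.val_succ]
    omega
  rw [h2, Finset.sum_insert (by simp)] at h
  omega

/-- Orthonormal bases of the layers, concatenated in the order of the blocks. -/
theorem exists_adapted_basis (hn : ∑ j, I j = n) (V : PartialFlag n I) :
    ∃ b : Fin n → EuclideanSpace ℝ (Fin n), Orthonormal ℝ b ∧
      ∀ m, b m ∈ V.space (blockIndex I hn m).succ := by
  have h := (orthogonalFamily_layers V).orthonormal_sigma_orthonormal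
    (v_family := fun j (a : Fin (I j)) =>
      ((stdOrthonormalBasis ℝ ↥((V.space j.castSucc)ᗮ ⊓ V.space j.succ)).reindex
        (finCongr (finrank_layer V j))) a) fun j => OrthonormalBasis.orthonormal _
  refine ⟨_, h.comp (fun m : Fin n => finSigmaFinEquiv.symm (Fin.cast hn.symm m))
    (finSigmaFinEquiv.symm.injective.comp (Fin.cast_injective _)), fun m => ?_⟩
  exact (Submodule.mem_inf.1 (Subtype.property (p := fun v => v ∈ (V.space
    (blockIndex I hn m).castSucc)ᗮ ⊓ V.space (blockIndex I hn m).succ) _)).2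

/-- Scaling the first column by `det B = ±1` corrects the orientation. Rescaling columns does not
enlarge their spans, so adapted bases stay adapted. For `n = 0` there is no column to rescale, but
the determinant is already 1. -/
theorem exists_sign_diagonal_mem_SO (B : Matrix (Fin n) (Fin n) ℝ)
    (hB : B ∈ Matrix.orthogonalGroup (Fin n) ℝ) :
    ∃ (Φ : SO n) (ε : Fin n → ℝ), Φ.1 = B * Matrix.diagonal ε := by
  rcases n with _ | n
  · exact ⟨⟨B, hB, by simp⟩, fun _ => 1, by ext i; exact i.elim0⟩
  have hdet : B.det * B.det = 1 := by
    have h := congrArg Matrix.det ((Matrix.mem_orthogonalGroup_iff' _ ℝ).1 hB)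
    rwa [Matrix.det_mul, Matrix.det_transpose, Matrix.det_one] at h
  have hε : Matrix.diagonal (Function.update (fun _ : Fin (n + 1) => (1 : ℝ)) 0 B.det) ∈
      Matrix.orthogonalGroup (Fin (n + 1)) ℝ := by
    rw [Matrix.mem_orthogonalGroup_iff, Matrix.diagonal_transpose,
      Matrix.diagonal_mul_diagonal, ← Matrix.diagonal_one]
    congr 1
    funext i
    rcases eq_or_ne i 0 with rfl | hi
    · simpa using hdet
    · simp [Function.update_of_ne hi]
  refine ⟨⟨_, mul_mem hB hε, ?_⟩, _, rfl⟩
  change Matrix.det _ = 1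
  rw [Matrix.det_mul, Matrix.det_diagonal, Finset.prod_update_of_mem (Finset.mem_univ _)]
  simpa using hdet

theorem flagProj_surjective (hI : ∀ j, 0 < I j) (hn : ∑ j, I j = n) :
    Function.Surjective (flagProj I hI hn) := by
  intro V
  obtain ⟨b, hb, hbV⟩ := exists_adapted_basis hn V
  have hB : (Matrix.of fun i m => b m i) ∈ Matrix.orthogonalGroup (Fin n) ℝ := by
    rw [Matrix.mem_orthogonalGroup_iff']
    ext i j
    have h := orthonormal_iff_ite.1 hb i j
    rw [PiLp.inner_apply] at h
    simpa [Matrix.mul_apply, Matrix.one_apply, mul_comm] using h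
  obtain ⟨Φ, ε, hΦ⟩ := exists_sign_diagonal_mem_SO _ hB
  refine ⟨Φ, ?_⟩
  ext1
  funext l
  -- Dimensions of flag spaces are prescribed, so one inclusion is enough.
  refine Submodule.eq_of_le_of_finrank_eq ?_ ?_
  · change Submodule.map _ (Submodule.span ℝ _) ≤ _
    rw [Submodule.map_span, Submodule.span_le]
    rintro _ ⟨_, ⟨m, hm, rfl⟩, rfl⟩
    have hcol : Matrix.toEuclideanLin Φ.1 (EuclideanSpace.single m (1 : ℝ)) = ε m • b m := by
      ext i
      simp [Matrix.toLpLin_apply, hΦ]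
    rw [hcol]
    refine Submodule.smul_mem _ _ (V.mono ?_ (hbV m))
    exact Fin.castSucc_lt_iff_succ_le.1 hm
  · rw [PartialFlag.finrank_space, PartialFlag.finrank_space]

theorem flagMat_flagProj (hI : ∀ j, 0 < I j) (hn : ∑ j, I j = n) (Ψ : SO n) (l : Fin (k + 1)) :
    flagMat (flagProj I hI hn Ψ) l = Ψ.1 * indMat (blockIndex I hn) l * Ψ.1ᵀ := by
  rw [flagProj, flagMat_moveFlag, flagMat_coordFlag]
  rfl

/-! ## Entrywise derivatives of curves of matrices -/

/-- The curve of matrices `γ` has velocity `X` at `0`. -/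
def HasEntryDeriv (γ : ℝ → Matrix (Fin n) (Fin n) ℝ) (X : Matrix (Fin n) (Fin n) ℝ) : Prop :=
  ∀ i j, HasDerivAt (fun t => γ t i j) (X i j) 0

theorem HasEntryDeriv.mul {γ δ : ℝ → Matrix (Fin n) (Fin n) ℝ} {X Y : Matrix (Fin n) (Fin n) ℝ}
    (hγ : HasEntryDeriv γ X) (hδ : HasEntryDeriv δ Y) :
    HasEntryDeriv (fun t => γ t * δ t) (X * δ 0 + γ 0 * Y) := by
  intro i j
  simp only [Matrix.add_apply, Matrix.mul_apply, ← Finset.sum_add_distrib]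
  exact HasDerivAt.fun_sum fun m _ => (hγ i m).mul (hδ m j)

theorem HasEntryDeriv.transpose {γ : ℝ → Matrix (Fin n) (Fin n) ℝ} {X : Matrix (Fin n) (Fin n) ℝ}
    (hγ : HasEntryDeriv γ X) : HasEntryDeriv (fun t => (γ t)ᵀ) Xᵀ :=
  fun i j => hγ j i

theorem HasEntryDeriv.sub {γ δ : ℝ → Matrix (Fin n) (Fin n) ℝ} {X Y : Matrix (Fin n) (Fin n) ℝ}
    (hγ : HasEntryDeriv γ X) (hδ : HasEntryDeriv δ Y) :
    HasEntryDeriv (fun t => γ t - δ t) (X - Y) :=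
  fun i j => (hγ i j).sub (hδ i j)

theorem hasEntryDeriv_const (S : Matrix (Fin n) (Fin n) ℝ) : HasEntryDeriv (fun _ => S) 0 :=
  fun _ _ => hasDerivAt_const _ _

theorem HasEntryDeriv.trace {γ : ℝ → Matrix (Fin n) (Fin n) ℝ} {X : Matrix (Fin n) (Fin n) ℝ}
    (hγ : HasEntryDeriv γ X) : HasDerivAt (fun t => (γ t).trace) X.trace 0 :=
  HasDerivAt.fun_sum fun i _ => hγ i i

/-- Reduces derivatives of operator-valued curves to those of finitely many scalar entries. -/
theorem toEuclideanCLM_eq_sum (A : Matrix (Fin n) (Fin n) ℝ) :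
    Matrix.toEuclideanCLM (n := Fin n) (𝕜 := ℝ) A =
      ∑ i, ∑ j, A i j • Matrix.toEuclideanCLM (n := Fin n) (𝕜 := ℝ) (Matrix.single i j 1) := by
  conv_lhs => rw [Matrix.matrix_eq_sum_single A]
  simp only [map_sum, ← map_smul, Matrix.smul_single, smul_eq_mul, mul_one]

theorem HasEntryDeriv.toEuclideanCLM {γ : ℝ → Matrix (Fin n) (Fin n) ℝ}
    {X : Matrix (Fin n) (Fin n) ℝ} (hγ : HasEntryDeriv γ X) :
    HasDerivAt (fun t => Matrix.toEuclideanCLM (n := Fin n) (𝕜 := ℝ) (γ t))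
      (Matrix.toEuclideanCLM (n := Fin n) (𝕜 := ℝ) X) 0 := by
  rw [toEuclideanCLM_eq_sum X, funext fun t => toEuclideanCLM_eq_sum (γ t)]
  exact HasDerivAt.fun_sum fun i _ => HasDerivAt.fun_sum fun j _ => (hγ i j).smul_const
    (Matrix.toEuclideanCLM (n := Fin n) (𝕜 := ℝ) (Matrix.single i j 1))

theorem soAlg_transpose (A : soAlg n) : A.1ᵀ = -A.1 :=
  (LieAlgebra.Orthogonal.mem_so (Fin n) ℝ A.1).1 A.2

/-- The velocity of the curve `γ S γᵀ` is a commutator. -/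
theorem IsCurve.hasEntryDeriv_conj {γ : ℝ → SO n} {Ψ : SO n} {A : soAlg n}
    (hγ : IsCurve γ Ψ (A.1 * Ψ.1)) (S : Matrix (Fin n) (Fin n) ℝ) :
    HasEntryDeriv (fun t => (γ t).1 * S * (γ t).1ᵀ)
      (A.1 * (Ψ.1 * S * Ψ.1ᵀ) - Ψ.1 * S * Ψ.1ᵀ * A.1) := by
  have h0 : HasEntryDeriv (fun t => (γ t).1) (A.1 * Ψ.1) := hγ.2
  have h := (h0.mul (hasEntryDeriv_const S)).mul h0.transpose
  convert h using 1
  rw [hγ.1, Matrix.transpose_mul, soAlg_transpose]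
  noncomm_ring

theorem hasEntryDeriv_soExp (A : soAlg n) : HasEntryDeriv (fun t => (soExp A t).1) A.1 := by
  -- An auxiliary norm, needed only to differentiate the exponential; the entry functionals are
  -- continuous in finite dimension.
  let _ : NormedRing (Matrix (Fin n) (Fin n) ℝ) := Matrix.linftyOpNormedRing
  let _ : NormedAlgebra ℝ (Matrix (Fin n) (Fin n) ℝ) := Matrix.linftyOpNormedAlgebra
  intro i j
  have h := hasDerivAt_exp_smul_const (𝕂 := ℝ) A.1 0
  rw [zero_smul, NormedSpace.exp_zero, one_mul] at h
  exact ((Matrix.entryLinearMap ℝ ℝ i j).toContinuousLinearMap.hasFDerivAt.comp_hasDerivAt 0 h)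

theorem soExp_zero (A : soAlg n) : soExp A 0 = 1 := by
  ext1
  change NormedSpace.exp ((0 : ℝ) • A.1) = 1
  rw [zero_smul, NormedSpace.exp_zero]

theorem isCurve_soExp_mul (A : soAlg n) (Ψ : SO n) :
    IsCurve (fun t => soExp A t * Ψ) Ψ (A.1 * Ψ.1) := by
  refine ⟨by simp only [soExp_zero, one_mul], ?_⟩
  have h := (hasEntryDeriv_soExp A).mul (hasEntryDeriv_const Ψ.1)
  rw [mul_zero, add_zero] at h
  exact h

theorem isCurve_soExp (A : soAlg n) : IsCurve (soExp A) 1 (A.1 * (1 : SO n).1) := by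
  simpa using isCurve_soExp_mul A 1

theorem moveFlag_one (V : PartialFlag n I) : moveFlag 1 V = V := by
  refine flagMat_injective (funext fun l => ?_)
  rw [flagMat_moveFlag]
  simp

/-- The differential of the orbit map. The velocity is determined by `A` and the flag at time 0, so
neither the curve nor the frame `Ψ` over that flag matters. -/
theorem IsCurve.hasDerivAt_embed {γ : ℝ → SO n} {Ψ : SO n} {A : soAlg n}
    (hγ : IsCurve γ Ψ (A.1 * Ψ.1)) (V : PartialFlag n I) :
    HasDerivAt (fun t => (moveFlag (γ t) V).embed)
      (fun l => Matrix.toEuclideanCLM (n := Fin n) (𝕜 := ℝ)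
        (A.1 * flagMat (moveFlag Ψ V) l - flagMat (moveFlag Ψ V) l * A.1)) 0 := by
  rw [hasDerivAt_pi]
  intro l
  simp only [embed_eq, flagMat_moveFlag]
  exact (hγ.hasEntryDeriv_conj _).toEuclideanCLM

/-! ## The symmetric matrix of a flag -/

/-- The symmetric matrix `L = ΨΛΨᵀ` as a function of the flag. -/
def flagSymm (lam : Fin k → ℝ) (V : PartialFlag n I) : Matrix (Fin n) (Fin n) ℝ :=
  ∑ j, lam j • (flagMat V j.succ - flagMat V j.castSucc)

theorem flagSymm_moveFlag (lam : Fin k → ℝ) (Φ : SO n) (V : PartialFlag n I) :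
    flagSymm lam (moveFlag Φ V) = Φ.1 * flagSymm lam V * Φ.1ᵀ := by
  simp only [flagSymm, flagMat_moveFlag, Finset.mul_sum, Finset.sum_mul, Matrix.mul_smul,
    Matrix.smul_mul, Matrix.mul_sub, Matrix.sub_mul]

theorem sum_smul_indMat (lam : Fin k → ℝ) (τ : Fin n → Fin k) :
    ∑ j, lam j • (indMat τ j.succ - indMat τ j.castSucc) = Matrix.diagonal fun m => lam (τ m) := by
  ext a b
  rw [Matrix.sum_apply]
  rcases eq_or_ne a b with rfl | h
  · simp only [indMat, Matrix.smul_apply, Matrix.sub_apply, Matrix.diagonal_apply_eq, smul_eq_mul]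
    -- The indicator of `τ a < l` jumps exactly once, between the levels `τ a` and `τ a + 1`.
    rw [Finset.sum_eq_single (τ a)]
    · simp
    · intro j _ hj
      have e : ((τ a).castSucc < j.succ) = ((τ a).castSucc < j.castSucc) := by
        simp only [Fin.lt_def, Fin.val_castSucc, Fin.val_succ, eq_iff_iff]
        have : (j : ℕ) ≠ τ a := fun h => hj (Fin.ext h)
        omega
      simp only [e, sub_self, mul_zero]
    · simp
  · simp [indMat, Matrix.diagonal_apply_ne _ h]

theorem flagSymm_coordFlag (lam : Fin k → ℝ) (τ : MultisetPerm n I) :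
    flagSymm lam (coordFlag τ) = Matrix.diagonal fun m => lam (τ.1 m) := by
  simp only [flagSymm, flagMat_coordFlag, sum_smul_indMat]

theorem flagSymm_flagProj (hI : ∀ j, 0 < I j) (hn : ∑ j, I j = n) (lam : Fin k → ℝ) (Ψ : SO n) :
    flagSymm lam (flagProj I hI hn Ψ) = Ψ.1 * eigMatrix I hn lam * Ψ.1ᵀ := by
  rw [flagProj, flagSymm_moveFlag, flagSymm_coordFlag]
  rfl

theorem flagSymm_transpose (hI : ∀ j, 0 < I j) (hn : ∑ j, I j = n) (lam : Fin k → ℝ)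
    (V : PartialFlag n I) : (flagSymm lam V)ᵀ = flagSymm lam V := by
  obtain ⟨Ψ, rfl⟩ := flagProj_surjective hI hn V
  rw [flagSymm_flagProj, Matrix.transpose_mul, Matrix.transpose_mul, Matrix.transpose_transpose,
    eigMatrix, Matrix.diagonal_transpose, Matrix.mul_assoc]

/-! ## The induced field and the induced function -/

theorem upperMinusLower_mem_so {L : Matrix (Fin n) (Fin n) ℝ} (hL : Lᵀ = L) :
    upperMinusLower L ∈ soAlg n := by
  rw [LieAlgebra.Orthogonal.mem_so]
  ext i j
  have h : L j i = L i j := congrFun (congrFun hL i) j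
  simp only [upperMinusLower, Matrix.transpose_apply, Matrix.of_apply, Matrix.neg_apply, h]
  rcases lt_trichotomy i j with hij | rfl | hij
  · simp [hij, hij.not_gt]
  · simp
  · simp [hij, hij.not_gt]

/-- The field induced by the Toda field. -/
def flagField (lam : Fin k → ℝ) (V : PartialFlag n I) : Ambient n k :=
  fun l => Matrix.toEuclideanCLM (n := Fin n) (𝕜 := ℝ)
    (upperMinusLower (flagSymm lam V) * flagMat V l -
      flagMat V l * upperMinusLower (flagSymm lam V))

/-- The antisymmetric matrix `L₊ - L₋` of a flag. -/
def flagGen (hI : ∀ j, 0 < I j) (hn : ∑ j, I j = n) (lam : Fin k → ℝ) (V : PartialFlag n I) :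
    soAlg n :=
  ⟨upperMinusLower (flagSymm lam V), upperMinusLower_mem_so (flagSymm_transpose hI hn lam V)⟩

theorem todaField_eq (hI : ∀ j, 0 < I j) (hn : ∑ j, I j = n) (lam : Fin k → ℝ) (Ψ : SO n) :
    todaField (eigMatrix I hn lam) Ψ = (flagGen hI hn lam (flagProj I hI hn Ψ)).1 * Ψ.1 := by
  rw [todaField, ← flagSymm_flagProj hI]
  rfl

/-- The curve `exp(tA)Ψ` realises the Toda velocity, so uniqueness of derivatives fixes the field at
`π(Ψ)`, and these points exhaust the flags. -/
theorem isInducedField_iff (hI : ∀ j, 0 < I j) (hn : ∑ j, I j = n) (lam : Fin k → ℝ)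
    (ξ : PartialFlag n I → Ambient n k) : IsInducedField I hI hn lam ξ ↔ ξ = flagField lam := by
  constructor
  · intro h
    funext V
    obtain ⟨Ψ, rfl⟩ := flagProj_surjective hI hn V
    have hc := isCurve_soExp_mul (flagGen hI hn lam (flagProj I hI hn Ψ)) Ψ
    exact (h Ψ _ (todaField_eq hI hn lam Ψ ▸ hc)).unique (hc.hasDerivAt_embed _)
  · rintro rfl Ψ γ hγ
    rw [todaField_eq hI] at hγ
    exact hγ.hasDerivAt_embed _

/-- The function induced by `F`. -/
def flagFun (lam : Fin k → ℝ) (V : PartialFlag n I) : ℝ :=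
  Matrix.trace (flagSymm lam V * Matrix.diagonal fun i : Fin n => ((i : ℕ) : ℝ))

theorem isInducedFun_iff (hI : ∀ j, 0 < I j) (hn : ∑ j, I j = n) (lam : Fin k → ℝ)
    (f : PartialFlag n I → ℝ) : IsInducedFun I hI hn lam f ↔ f = flagFun lam := by
  have h : ∀ Ψ, flagFun lam (flagProj I hI hn Ψ) = todaFun (eigMatrix I hn lam) Ψ := by
    intro Ψ
    rw [flagFun, flagSymm_flagProj, todaFun]
  constructor
  · intro hf
    funext V
    obtain ⟨Ψ, rfl⟩ := flagProj_surjective hI hn V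
    rw [hf, h]
  · rintro rfl
    exact h

/-! ## Trace identities -/

theorem trace_commutator_mul_diagonal (C L : Matrix (Fin n) (Fin n) ℝ) (hL : Lᵀ = L) :
    Matrix.trace ((C * L - L * C) * Matrix.diagonal fun i : Fin n => ((i : ℕ) : ℝ)) =
      -∑ i, ∑ j, C i j * (((j : ℕ) : ℝ) - ((i : ℕ) : ℝ)) * L i j := by
  have h : ∀ i j, L j i = L i j := fun i j => congrFun (congrFun hL i) j
  rw [Matrix.sub_mul, Matrix.trace_sub]
  simp only [Matrix.trace, Matrix.diag_apply, Matrix.mul_diagonal]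
  simp only [Matrix.mul_apply, Finset.sum_mul]
  rw [Finset.sum_comm (f := fun i j => L i j * C j i * ((i : ℕ) : ℝ)), ← Finset.sum_sub_distrib,
    ← Finset.sum_neg_distrib]
  refine Finset.sum_congr rfl fun i _ => ?_
  rw [← Finset.sum_sub_distrib, ← Finset.sum_neg_distrib]
  refine Finset.sum_congr rfl fun j _ => ?_
  rw [h]
  ring

theorem todaInner_eq_sum (C A : Matrix (Fin n) (Fin n) ℝ) (hA : Aᵀ = -A) :
    todaInner C A = ∑ i, ∑ j, C i j * |((i : ℕ) : ℝ) - ((j : ℕ) : ℝ)| * A i j := by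
  have h : ∀ i j, A j i = -A i j := fun i j => congrFun (congrFun hA i) j
  simp only [todaInner, Matrix.trace, Matrix.diag_apply, Matrix.mul_apply, Matrix.of_apply,
    ← Finset.sum_neg_distrib]
  refine Finset.sum_congr rfl fun i _ => Finset.sum_congr rfl fun j _ => ?_
  rw [h i j, abs_sub_comm]
  ring

theorem abs_sub_mul_upperMinusLower (L : Matrix (Fin n) (Fin n) ℝ) (i j : Fin n) :
    |((i : ℕ) : ℝ) - ((j : ℕ) : ℝ)| * upperMinusLower L i j =
      (((j : ℕ) : ℝ) - ((i : ℕ) : ℝ)) * L i j := by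
  simp only [upperMinusLower, Matrix.of_apply]
  rcases lt_trichotomy i j with hij | rfl | hij
  · have h : ((i : ℕ) : ℝ) < ((j : ℕ) : ℝ) := by exact_mod_cast hij
    rw [if_pos hij, abs_of_neg (by linarith)]
    ring
  · simp
  · have h : ((j : ℕ) : ℝ) < ((i : ℕ) : ℝ) := by exact_mod_cast hij
    rw [if_neg hij.not_gt, if_pos hij, abs_of_pos (by linarith)]
    ring

/-- The identity behind the gradient property: the weight `|i - j|` turns the sign of `L₊ - L₋` into
the factor `j - i` that `N` produces in the commutator trace. -/
theorem todaInner_upperMinusLower (C L : Matrix (Fin n) (Fin n) ℝ) (hL : Lᵀ = L) :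
    todaInner C (upperMinusLower L) =
      -Matrix.trace ((C * L - L * C) * Matrix.diagonal fun i : Fin n => ((i : ℕ) : ℝ)) := by
  rw [todaInner_eq_sum _ _
    ((LieAlgebra.Orthogonal.mem_so (Fin n) ℝ _).1 (upperMinusLower_mem_so hL)),
    trace_commutator_mul_diagonal C L hL, neg_neg]
  simp only [mul_assoc, abs_sub_mul_upperMinusLower]

theorem todaInner_comm (A C : soAlg n) : todaInner A.1 C.1 = todaInner C.1 A.1 := by
  rw [todaInner_eq_sum _ _ (soAlg_transpose A), todaInner_eq_sum _ _ (soAlg_transpose C)]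
  refine Finset.sum_congr rfl fun i _ => Finset.sum_congr rfl fun j _ => ?_
  ring

/-- The weights `|i - j|` vanish only on the diagonal, where an antisymmetric matrix is zero anyway.
-/
theorem eq_zero_of_todaInner_self (A : soAlg n) (h : todaInner A.1 A.1 = 0) : A.1 = 0 := by
  rw [todaInner_eq_sum _ _ (soAlg_transpose A)] at h
  have hnn : ∀ i j, 0 ≤ A.1 i j * |((i : ℕ) : ℝ) - ((j : ℕ) : ℝ)| * A.1 i j := by
    intro i j
    have : A.1 i j * |((i : ℕ) : ℝ) - ((j : ℕ) : ℝ)| * A.1 i j =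
      |((i : ℕ) : ℝ) - ((j : ℕ) : ℝ)| * (A.1 i j * A.1 i j) := by ring
    rw [this]
    exact mul_nonneg (abs_nonneg _) (mul_self_nonneg _)
  rw [Finset.sum_eq_zero_iff_of_nonneg fun i _ => Finset.sum_nonneg fun j _ => hnn i j] at h
  ext i j
  have hij := (Finset.sum_eq_zero_iff_of_nonneg fun j _ => hnn i j).1 (h i (Finset.mem_univ _)) j
    (Finset.mem_univ _)
  rcases eq_or_ne i j with rfl | hne
  · have h2 : A.1 i i = -A.1 i i := congrFun (congrFun (soAlg_transpose A) i) i
    change A.1 i i = 0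
    linarith
  · have h3 : |((i : ℕ) : ℝ) - ((j : ℕ) : ℝ)| ≠ 0 := by
      rw [abs_ne_zero, sub_ne_zero]
      exact_mod_cast fun h => hne (Fin.ext h)
    simpa [h3] using hij

/-- A symmetric matrix `S` with `Tr([C, S] N) = 0` for all antisymmetric `C` is diagonal. -/
theorem offDiag_eq_zero_of_trace (S : Matrix (Fin n) (Fin n) ℝ) (hS : Sᵀ = S)
    (h : ∀ C : soAlg n, Matrix.trace ((C.1 * S - S * C.1) *
      Matrix.diagonal fun i : Fin n => ((i : ℕ) : ℝ)) = 0) {i j : Fin n} (hij : i ≠ j) :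
    S i j = 0 := by
  -- Test against `C = S₊ - S₋`: the trace becomes minus its squared length.
  have h1 := h ⟨_, upperMinusLower_mem_so hS⟩
  rw [← neg_eq_zero, ← todaInner_upperMinusLower _ _ hS] at h1
  have h2 := eq_zero_of_todaInner_self ⟨_, upperMinusLower_mem_so hS⟩ h1
  have h3 := congrFun (congrFun h2 i) j
  simp only [upperMinusLower, Matrix.of_apply, Matrix.zero_apply] at h3
  rcases lt_or_gt_of_ne hij with h' | h'
  · simpa [h'] using h3
  · simpa [h', h'.not_gt] using h3

/-! ## Coordinate flags -/

theorem coordFlag_injective :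
    Function.Injective (fun τ : MultisetPerm n I => coordFlag τ) := by
  intro τ σ h
  have h1 : ∀ m l, (τ.1 m).castSucc < l ↔ (σ.1 m).castSucc < l := by
    intro m l
    have h2 : flagMat (coordFlag τ) l m m = flagMat (coordFlag σ) l m m := by
      rw [show coordFlag τ = coordFlag σ from h]
    rw [flagMat_coordFlag, flagMat_coordFlag, indMat, indMat, Matrix.diagonal_apply_eq,
      Matrix.diagonal_apply_eq] at h2
    by_cases ha : (τ.1 m).castSucc < l <;> by_cases hb : (σ.1 m).castSucc < l <;>
      first
        | exact iff_of_true ha hb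
        | exact iff_of_false ha hb
        | simp [ha, hb] at h2
  ext m : 2
  -- The value `τ m` is recovered as the last level whose space does not contain `e_m`.
  have ha := (h1 m (τ.1 m).succ).1 Fin.castSucc_lt_succ
  have hb := (h1 m (σ.1 m).succ).2 Fin.castSucc_lt_succ
  exact le_antisymm (Fin.castSucc_lt_succ_iff.1 hb) (Fin.castSucc_lt_succ_iff.1 ha)

/-- The support condition on `Ψ` says that it intertwines the block projections with the coordinate
projections of `τ`. -/
theorem flagProj_eq_coordFlag (hI : ∀ j, 0 < I j) (hn : ∑ j, I j = n) (Ψ : SO n)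
    (τ : MultisetPerm n I) (h : ∀ i j, Ψ.1 i j ≠ 0 → τ.1 i = blockIndex I hn j) :
    flagProj I hI hn Ψ = coordFlag τ := by
  refine flagMat_injective (funext fun l => ?_)
  have h1 : Ψ.1 * indMat (blockIndex I hn) l = indMat τ.1 l * Ψ.1 := by
    ext i j
    rw [indMat, indMat, Matrix.mul_diagonal, Matrix.diagonal_mul, mul_comm]
    by_cases hij : Ψ.1 i j = 0
    · rw [hij, mul_zero, mul_zero]
    · rw [h i j hij]
  rw [flagMat_flagProj, flagMat_coordFlag, h1, Matrix.mul_assoc, SO.mul_transpose, Matrix.mul_one]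

theorem SO.sum_row_sq (Ψ : SO n) (i : Fin n) : ∑ j, Ψ.1 i j * Ψ.1 i j = 1 := by
  have h := congrFun (congrFun (SO.mul_transpose Ψ) i) i
  rwa [Matrix.mul_apply, Matrix.one_apply_eq] at h

theorem SO.sum_col_sq (Ψ : SO n) (j : Fin n) : ∑ i, Ψ.1 i j * Ψ.1 i j = 1 := by
  have h := congrFun (congrFun (SO.transpose_mul Ψ) j) j
  rwa [Matrix.mul_apply, Matrix.one_apply_eq] at h

/-- Read entrywise, `LΨ = ΨΛ` with diagonal `L` says that `Ψ_{ij} ≠ 0` forces `L_{ii}` to be the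
eigenvalue of the block of `j`. Eigenvalues of different blocks differ, so each row of `Ψ` is
supported in a single block, and `τ` records that block. -/
theorem exists_coordFlag_of_offDiag (hI : ∀ j, 0 < I j) (hn : ∑ j, I j = n) {lam : Fin k → ℝ}
    (hlam : StrictMono lam) (V : PartialFlag n I)
    (hV : ∀ i j, i ≠ j → flagSymm lam V i j = 0) : ∃ τ : MultisetPerm n I, coordFlag τ = V := by
  obtain ⟨Ψ, rfl⟩ := flagProj_surjective hI hn V
  set L := flagSymm lam (flagProj I hI hn Ψ) with hLdef
  have hL : Matrix.diagonal (fun i => L i i) = L := by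
    ext i j
    rcases eq_or_ne i j with rfl | hij
    · rw [Matrix.diagonal_apply_eq]
    · rw [Matrix.diagonal_apply_ne _ hij, hV i j hij]
  have h1 : L * Ψ.1 = Ψ.1 * eigMatrix I hn lam := by
    rw [hLdef, flagSymm_flagProj, Matrix.mul_assoc, SO.transpose_mul, Matrix.mul_one]
  have h2 : ∀ i j, Ψ.1 i j ≠ 0 → L i i = lam (blockIndex I hn j) := by
    intro i j hij
    have h3 := congrFun (congrFun h1 i) j
    rw [← hL, eigMatrix, Matrix.mul_diagonal, Matrix.diagonal_mul, mul_comm] at h3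
    exact mul_left_cancel₀ hij h3
  have h4 : ∀ i, ∃ j, Ψ.1 i j ≠ 0 := by
    intro i
    by_contra! h
    have h5 := SO.sum_row_sq Ψ i
    simp [h] at h5
  choose p hp using h4
  have h5 : ∀ i j, Ψ.1 i j ≠ 0 → blockIndex I hn (p i) = blockIndex I hn j := fun i j hij =>
    hlam.injective ((h2 i _ (hp i)).symm.trans (h2 i j hij))
  have hcard : ∀ j, (Finset.univ.filter fun m => blockIndex I hn (p m) = j).card = I j := by
    intro j
    rw [← card_blockIndex I hn j, ← Nat.cast_inj (R := ℝ), Finset.card_filter, Finset.card_filter]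
    push_cast
    -- Double counting with the doubly stochastic weights `Ψ_{im}²`: rows supported in block `j` are
    -- as numerous as its columns.
    calc ∑ i, (if blockIndex I hn (p i) = j then (1 : ℝ) else 0)
        = ∑ i, ∑ m, (if blockIndex I hn (p i) = j then (1 : ℝ) else 0) *
            (Ψ.1 i m * Ψ.1 i m) := by
          simp only [← Finset.mul_sum, SO.sum_row_sq, mul_one]
      _ = ∑ i, ∑ m, (if blockIndex I hn m = j then (1 : ℝ) else 0) *
            (Ψ.1 i m * Ψ.1 i m) := by
          refine Finset.sum_congr rfl fun i _ => Finset.sum_congr rfl fun m _ => ?_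
          by_cases hm : Ψ.1 i m = 0
          · rw [hm, mul_zero, mul_zero, mul_zero]
          · rw [h5 i m hm]
      _ = ∑ m, (if blockIndex I hn m = j then (1 : ℝ) else 0) := by
          rw [Finset.sum_comm]
          simp only [← Finset.mul_sum, SO.sum_col_sq, mul_one]
  refine ⟨⟨fun i => blockIndex I hn (p i), fun j => ?_, hcard⟩, ?_⟩
  · have h6 : (Finset.univ.filter fun m => blockIndex I hn (p m) = j).Nonempty := by
      rw [← Finset.card_pos, hcard]
      exact hI j
    obtain ⟨m, hm⟩ := h6
    exact ⟨m, by simpa using hm⟩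
  · exact (flagProj_eq_coordFlag hI hn Ψ _ h5).symm

theorem flagProj_signedPerm (hI : ∀ j, 0 < I j) (hn : ∑ j, I j = n) (w : Equiv.Perm (Fin n))
    (Ψ : SO n) (h : ∀ j, |Ψ.1 j (w j)| = 1) :
    flagProj I hI hn Ψ = coordFlag ((blockPerm I hI hn).comp w) := by
  refine flagProj_eq_coordFlag hI hn Ψ _ fun i j hij => ?_
  suffices hw : w i = j by
    rw [← hw]
    rfl
  by_contra hne
  -- An entry of modulus 1 exhausts the unit row, so all other entries vanish.
  have h1 := SO.sum_row_sq Ψ i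
  rw [← Finset.add_sum_erase _ _ (Finset.mem_univ (w i)), ← abs_mul_abs_self, h i, one_mul,
    add_eq_left, Finset.sum_eq_zero_iff_of_nonneg fun _ _ => mul_self_nonneg _] at h1
  have h2 := h1 j (by simpa using Ne.symm hne)
  exact hij (mul_self_eq_zero.1 h2)

/-! ## Zeros of the field -/

theorem commute_flagSymm_of_commute {lam : Fin k → ℝ} {V : PartialFlag n I}
    {A : Matrix (Fin n) (Fin n) ℝ} (h : ∀ l, A * flagMat V l - flagMat V l * A = 0) :
    A * flagSymm lam V - flagSymm lam V * A = 0 := by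
  rw [sub_eq_zero]
  have h' : ∀ l, Commute A (flagMat V l) := fun l => sub_eq_zero.1 (h l)
  exact Commute.sum_right _ _ _ fun j _ => ((h' _).sub_right (h' _)).smul_right _

theorem flagField_eq_zero_iff (hI : ∀ j, 0 < I j) (hn : ∑ j, I j = n) {lam : Fin k → ℝ}
    (hlam : StrictMono lam) (V : PartialFlag n I) :
    flagField lam V = 0 ↔ ∃ τ : MultisetPerm n I, coordFlag τ = V := by
  constructor
  · intro h
    refine exists_coordFlag_of_offDiag hI hn hlam V fun i j hij => ?_
    have h1 : ∀ l, upperMinusLower (flagSymm lam V) * flagMat V l -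
        flagMat V l * upperMinusLower (flagSymm lam V) = 0 := by
      intro l
      refine EquivLike.injective (Matrix.toEuclideanCLM (n := Fin n) (𝕜 := ℝ)) ?_
      rw [map_zero]
      exact congrFun h l
    have h2 := commute_flagSymm_of_commute (lam := lam) h1
    have hS := flagSymm_transpose hI hn lam V
    -- With `C = L₊ - L₋`, which commutes with `L`, the squared length of `C` is zero.
    have h3 := todaInner_upperMinusLower (upperMinusLower (flagSymm lam V)) _ hS
    rw [h2, Matrix.zero_mul, Matrix.trace_zero, neg_zero] at h3
    have h4 := congrFun (congrFun (eq_zero_of_todaInner_self ⟨_, upperMinusLower_mem_so hS⟩ h3) i) j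
    simp only [upperMinusLower, Matrix.of_apply, Matrix.zero_apply] at h4
    rcases lt_or_gt_of_ne hij with h' | h'
    · simpa [h'] using h4
    · simpa [h', h'.not_gt] using h4
  · rintro ⟨τ, rfl⟩
    have h : upperMinusLower (flagSymm lam (coordFlag τ)) = 0 := by
      ext i j
      rw [flagSymm_coordFlag]
      simp only [upperMinusLower, Matrix.of_apply, Matrix.zero_apply]
      rcases lt_trichotomy i j with h | rfl | h
      · simp [h, h.ne]
      · simp
      · simp [h, h.not_gt, h.ne']
    funext l
    simp [flagField, h]

/-! ## The gradient property -/

theorem IsCurve.hasDerivAt_flagFun {γ : ℝ → SO n} {Ψ : SO n} {A : soAlg n}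
    (hγ : IsCurve γ Ψ (A.1 * Ψ.1)) (lam : Fin k → ℝ) (V : PartialFlag n I) :
    HasDerivAt (fun t => -flagFun lam (moveFlag (γ t) V))
      (-Matrix.trace ((A.1 * flagSymm lam (moveFlag Ψ V) - flagSymm lam (moveFlag Ψ V) * A.1) *
        Matrix.diagonal fun i : Fin n => ((i : ℕ) : ℝ))) 0 := by
  have h := ((hγ.hasEntryDeriv_conj (flagSymm lam V)).mul
    (hasEntryDeriv_const (Matrix.diagonal fun i : Fin n => ((i : ℕ) : ℝ)))).trace.neg
  rw [mul_zero, add_zero, ← flagSymm_moveFlag] at h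
  simp only [flagFun, flagSymm_moveFlag] at h ⊢
  exact h

theorem conj_mem_so (X : soAlg n) (Ψ : SO n) : Ψ.1 * X.1 * Ψ.1ᵀ ∈ soAlg n := by
  rw [LieAlgebra.Orthogonal.mem_so, Matrix.transpose_mul, Matrix.transpose_mul,
    Matrix.transpose_transpose, soAlg_transpose]
  noncomm_ring

/-- A block diagonal `X` commutes with `Λ`, so the fibre direction `ΨXΨᵀ` commutes with `L` and
pairs to zero with `L₊ - L₋`. -/
theorem isHorizontal_flagGen (hI : ∀ j, 0 < I j) (hn : ∑ j, I j = n) (lam : Fin k → ℝ)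
    (Ψ : SO n) : IsHorizontal I hn Ψ (flagGen hI hn lam (flagProj I hI hn Ψ)) := by
  intro X hX
  have hc := todaInner_comm (flagGen hI hn lam (flagProj I hI hn Ψ)) ⟨_, conj_mem_so X Ψ⟩
  change todaInner _ (Ψ.1 * X.1 * Ψ.1ᵀ) = todaInner (Ψ.1 * X.1 * Ψ.1ᵀ) (upperMinusLower _) at hc
  rw [hc, todaInner_upperMinusLower _ _ (flagSymm_transpose hI hn lam _), flagSymm_flagProj]
  have hcomm : X.1 * eigMatrix I hn lam = eigMatrix I hn lam * X.1 := by
    ext i j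
    rw [eigMatrix, Matrix.mul_diagonal, Matrix.diagonal_mul, mul_comm]
    by_cases hij : blockIndex I hn i = blockIndex I hn j
    · rw [hij]
    · rw [hX i j hij, mul_zero, mul_zero]
  have h0 : Ψ.1 * X.1 * Ψ.1ᵀ * (Ψ.1 * eigMatrix I hn lam * Ψ.1ᵀ) -
      Ψ.1 * eigMatrix I hn lam * Ψ.1ᵀ * (Ψ.1 * X.1 * Ψ.1ᵀ) = 0 := by
    have e : ∀ S T : Matrix (Fin n) (Fin n) ℝ,
        Ψ.1 * S * Ψ.1ᵀ * (Ψ.1 * T * Ψ.1ᵀ) = Ψ.1 * (S * T) * Ψ.1ᵀ := by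
      intro S T
      calc Ψ.1 * S * Ψ.1ᵀ * (Ψ.1 * T * Ψ.1ᵀ) = Ψ.1 * S * (Ψ.1ᵀ * Ψ.1) * T * Ψ.1ᵀ := by
            noncomm_ring
        _ = Ψ.1 * (S * T) * Ψ.1ᵀ := by
            rw [SO.transpose_mul]
            noncomm_ring
    rw [e, e, hcomm, sub_self]
  rw [h0, Matrix.zero_mul, Matrix.trace_zero, neg_zero]

theorem isGradientField_flagField (hI : ∀ j, 0 < I j) (hn : ∑ j, I j = n) (lam : Fin k → ℝ) :
    IsGradientField I hI hn (fun V => -flagFun lam V) (flagField lam) := by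
  intro Ψ
  refine ⟨flagGen hI hn lam (flagProj I hI hn Ψ), isHorizontal_flagGen hI hn lam Ψ,
    fun γ hγ => hγ.hasDerivAt_embed _, fun C _ γ hγ => ?_⟩
  have h := hγ.hasDerivAt_flagFun lam (coordFlag (blockPerm I hI hn))
  rw [← todaInner_upperMinusLower _ _ (flagSymm_transpose hI hn lam _)] at h
  exact h

/-! ## The Morse property -/

/-- Since `N` is diagonal, only diagonal entries of the projections enter, and these are linear in
the embedded operators; the extension is linear. -/
theorem exists_contDiff_flagFun (lam : Fin k → ℝ) :
    ∃ g : Ambient n k → ℝ, ContDiff ℝ (⊤ : ℕ∞) g ∧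
      ∀ V : PartialFlag n I, -flagFun lam V = g V.embed := by
  have hentry : ∀ (l : Fin (k + 1)) (i : Fin n), ContDiff ℝ (⊤ : ℕ∞) fun a : Ambient n k =>
      (Matrix.toEuclideanCLM (n := Fin n) (𝕜 := ℝ)).symm (a l) i i := by
    intro l i
    have h : ∀ T : EuclideanSpace ℝ (Fin n) →L[ℝ] EuclideanSpace ℝ (Fin n),
        (Matrix.toEuclideanCLM (n := Fin n) (𝕜 := ℝ)).symm T i i =
          EuclideanSpace.proj (𝕜 := ℝ) i (T (EuclideanSpace.single i 1)) := by
      intro T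
      obtain ⟨A, rfl⟩ := EquivLike.surjective (Matrix.toEuclideanCLM (n := Fin n) (𝕜 := ℝ)) T
      rw [StarAlgEquiv.symm_apply_apply, PiLp.proj_apply, Matrix.ofLp_toEuclideanCLM]
      simp
    simp only [h]
    fun_prop
  refine ⟨fun a => -∑ i : Fin n, (∑ j : Fin k, lam j *
    ((Matrix.toEuclideanCLM (n := Fin n) (𝕜 := ℝ)).symm (a j.succ) i i -
      (Matrix.toEuclideanCLM (n := Fin n) (𝕜 := ℝ)).symm (a j.castSucc) i i)) * ((i : ℕ) : ℝ),
    ?_, fun V => ?_⟩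
  · exact (ContDiff.sum fun i _ => (ContDiff.sum fun j _ => contDiff_const.mul
      ((hentry _ i).sub (hentry _ i))).mul contDiff_const).neg
  · simp only [flagFun, Matrix.trace, Matrix.diag_apply, Matrix.mul_diagonal, flagSymm,
      Matrix.sum_apply, Matrix.smul_apply, Matrix.sub_apply, smul_eq_mul, flagMat]

theorem flagDeriv_flagFun (lam : Fin k → ℝ) (A : soAlg n) (V : PartialFlag n I) :
    flagDeriv A (fun V => -flagFun lam V) V =
      -Matrix.trace ((A.1 * flagSymm lam V - flagSymm lam V * A.1) *
        Matrix.diagonal fun i : Fin n => ((i : ℕ) : ℝ)) := by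
  have h := ((isCurve_soExp A).hasDerivAt_flagFun lam V).deriv
  rwa [moveFlag_one] at h

/-- The first derivative is linear in `L` with `C` fixed, so differentiating along `A` replaces `L`
by `[A, L]`. -/
theorem flagDeriv_flagDeriv_flagFun (lam : Fin k → ℝ) (A C : soAlg n) (V : PartialFlag n I) :
    flagDeriv A (flagDeriv C fun V => -flagFun lam V) V =
      -Matrix.trace ((C.1 * (A.1 * flagSymm lam V - flagSymm lam V * A.1) -
        (A.1 * flagSymm lam V - flagSymm lam V * A.1) * C.1) *
        Matrix.diagonal fun i : Fin n => ((i : ℕ) : ℝ)) := by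
  have hd : HasEntryDeriv (fun t => flagSymm lam (moveFlag (soExp A t) V))
      (A.1 * flagSymm lam V - flagSymm lam V * A.1) := by
    have h := (isCurve_soExp A).hasEntryDeriv_conj (flagSymm lam V)
    rw [← flagSymm_moveFlag, moveFlag_one] at h
    simpa only [flagSymm_moveFlag] using h
  have h1 := (hasEntryDeriv_const C.1).mul hd
  have h2 := hd.mul (hasEntryDeriv_const C.1)
  rw [zero_mul, zero_add] at h1
  rw [mul_zero, add_zero] at h2
  have h3 := ((h1.sub h2).mul
    (hasEntryDeriv_const (Matrix.diagonal fun i : Fin n => ((i : ℕ) : ℝ)))).trace.neg.deriv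
  rw [mul_zero, add_zero] at h3
  rw [flagDeriv]
  simp only [flagDeriv_flagFun]
  exact h3

theorem commutator_transpose {L : Matrix (Fin n) (Fin n) ℝ} (hL : Lᵀ = L) (A : soAlg n) :
    (A.1 * L - L * A.1)ᵀ = A.1 * L - L * A.1 := by
  rw [Matrix.transpose_sub, Matrix.transpose_mul, Matrix.transpose_mul, hL, soAlg_transpose]
  noncomm_ring

/-- In the frame `Ψ`, where `L` becomes `Λ`, commuting means `B_{ij}(λ_j - λ_i) = 0` with the
eigenvalues of the blocks of `i` and `j`. Distinct eigenvalues make `B` block diagonal, so it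
commutes with the block projections. -/
theorem commute_flagMat_of_commute (hI : ∀ j, 0 < I j) (hn : ∑ j, I j = n) {lam : Fin k → ℝ}
    (hlam : StrictMono lam) {V : PartialFlag n I} {A : Matrix (Fin n) (Fin n) ℝ}
    (h : A * flagSymm lam V - flagSymm lam V * A = 0) (l : Fin (k + 1)) :
    A * flagMat V l - flagMat V l * A = 0 := by
  obtain ⟨Ψ, rfl⟩ := flagProj_surjective hI hn V
  have e : ∀ S : Matrix (Fin n) (Fin n) ℝ, A * (Ψ.1 * S * Ψ.1ᵀ) - Ψ.1 * S * Ψ.1ᵀ * A =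
      Ψ.1 * ((Ψ.1ᵀ * A * Ψ.1) * S - S * (Ψ.1ᵀ * A * Ψ.1)) * Ψ.1ᵀ := by
    intro S
    calc A * (Ψ.1 * S * Ψ.1ᵀ) - Ψ.1 * S * Ψ.1ᵀ * A
        = (Ψ.1 * Ψ.1ᵀ) * A * Ψ.1 * S * Ψ.1ᵀ - Ψ.1 * S * Ψ.1ᵀ * A * (Ψ.1 * Ψ.1ᵀ) := by
          rw [SO.mul_transpose]
          noncomm_ring
      _ = _ := by noncomm_ring
  rw [flagSymm_flagProj, e] at h
  rw [flagMat_flagProj, e]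
  set B := Ψ.1ᵀ * A * Ψ.1
  have h1 : B * eigMatrix I hn lam - eigMatrix I hn lam * B = 0 := by
    calc B * eigMatrix I hn lam - eigMatrix I hn lam * B
        = (Ψ.1ᵀ * Ψ.1) * (B * eigMatrix I hn lam - eigMatrix I hn lam * B) * (Ψ.1ᵀ * Ψ.1) := by
          rw [SO.transpose_mul, Matrix.one_mul, Matrix.mul_one]
      _ = Ψ.1ᵀ * (Ψ.1 * (B * eigMatrix I hn lam - eigMatrix I hn lam * B) * Ψ.1ᵀ) * Ψ.1 := by
          simp only [Matrix.mul_assoc]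
      _ = 0 := by rw [h, Matrix.mul_zero, Matrix.zero_mul]
  have h2 : B * indMat (blockIndex I hn) l - indMat (blockIndex I hn) l * B = 0 := by
    ext i j
    have h3 := congrFun (congrFun h1 i) j
    rw [eigMatrix, Matrix.sub_apply, Matrix.mul_diagonal, Matrix.diagonal_mul, Matrix.zero_apply,
      mul_comm, ← sub_mul, mul_eq_zero, sub_eq_zero] at h3
    rw [indMat, Matrix.sub_apply, Matrix.mul_diagonal, Matrix.diagonal_mul, Matrix.zero_apply,
      mul_comm, ← sub_mul, mul_eq_zero, sub_eq_zero]
    refine h3.imp_left fun h4 => ?_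
    rw [hlam.injective h4]
  rw [h2, Matrix.mul_zero, Matrix.zero_mul]

theorem isMorse_flagFun (hI : ∀ j, 0 < I j) (hn : ∑ j, I j = n) {lam : Fin k → ℝ}
    (hlam : StrictMono lam) : IsMorse fun V : PartialFlag n I => -flagFun lam V := by
  refine ⟨exists_contDiff_flagFun lam, fun V hcrit A hA => ?_⟩
  have hS := flagSymm_transpose hI hn lam V
  have hoff : ∀ i j, i ≠ j → flagSymm lam V i j = 0 := fun i j hij =>
    offDiag_eq_zero_of_trace _ hS
      (fun C => by simpa [flagDeriv_flagFun] using hcrit C) hij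
  have hcomm : A.1 * flagSymm lam V - flagSymm lam V * A.1 = 0 := by
    ext i j
    -- The Hessian controls only off-diagonal entries of `[A, L]`; the diagonal ones vanish because
    -- `L` is diagonal at a critical point.
    rcases eq_or_ne i j with rfl | hij
    · rw [Matrix.sub_apply, Matrix.mul_apply, Matrix.mul_apply, Matrix.zero_apply,
        Finset.sum_eq_single i (fun m _ hm => by rw [hoff m i hm, mul_zero]) (by simp),
        Finset.sum_eq_single i (fun m _ hm => by rw [hoff i m hm.symm, zero_mul]) (by simp)]
      ring
    · exact offDiag_eq_zero_of_trace _ (commutator_transpose hS A)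
        (fun C => by simpa only [flagDeriv_flagDeriv_flagFun, neg_eq_zero] using hA C) hij
  have h := (isCurve_soExp A).hasDerivAt_embed V
  rw [moveFlag_one] at h
  simp only [commute_flagMat_of_commute hI hn hlam hcomm, map_zero] at h
  exact h

end FSToda

end

theorem mainTheorem4 (n k : ℕ) (I : Fin k → ℕ) (hI : ∀ j, 0 < I j) (hn : ∑ j, I j = n)
    (lam : Fin k → ℝ) (hlam : StrictMono lam) :
    (∃! ξ : FSToda.PartialFlag n I → FSToda.Ambient n k, FSToda.IsInducedField I hI hn lam ξ) ∧
    (∃! f : FSToda.PartialFlag n I → ℝ, FSToda.IsInducedFun I hI hn lam f) ∧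
    ∀ (ξ : FSToda.PartialFlag n I → FSToda.Ambient n k) (f : FSToda.PartialFlag n I → ℝ),
      FSToda.IsInducedField I hI hn lam ξ → FSToda.IsInducedFun I hI hn lam f →
        FSToda.IsMorse (fun V => -f V) ∧
        FSToda.IsGradientField I hI hn (fun V => -f V) ξ ∧
        Set.BijOn (fun τ : FSToda.MultisetPerm n I => FSToda.coordFlag τ) Set.univ
          {V | ξ V = 0} ∧
        ∀ (w : Equiv.Perm (Fin n)) (Ψ : FSToda.SO n), (∀ j, |Ψ.1 j (w j)| = 1) →
          FSToda.flagProj I hI hn Ψ =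
            FSToda.coordFlag ((FSToda.blockPerm I hI hn).comp w) := by
  simp only [FSToda.isInducedField_iff, FSToda.isInducedFun_iff]
  refine ⟨⟨_, rfl, fun _ h => h⟩, ⟨_, rfl, fun _ h => h⟩, ?_⟩
  rintro ξ f rfl rfl
  refine ⟨FSToda.isMorse_flagFun hI hn hlam, FSToda.isGradientField_flagField hI hn lam,
    ⟨fun τ _ => ?_, FSToda.coordFlag_injective.injOn, fun V hV => ?_⟩,
    FSToda.flagProj_signedPerm hI hn⟩
  · exact (FSToda.flagField_eq_zero_iff hI hn hlam _).2 ⟨τ, rfl⟩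
  · obtain ⟨τ, hτ⟩ := (FSToda.flagField_eq_zero_iff hI hn hlam V).1 hV
    exact ⟨τ, Set.mem_univ _, hτ⟩
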